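/- Let $q\in[0,1)$, put $[k]_q=1+q+\cdots+q^{k-1}$ for $k\ge 1$ and $[k]_q!=[1]_q[2]_q\cdots[k]_q$, $[0]_q!=1$ (with $0^0=1$). Let $T(z)=\sum_{k=0}^\infty T_kz^k$, $T_k\in\mathbb C^{n\times m}$, be a power series converging in a disk $|z|<r$, $r>0$. For a function $f$ analytic in this disk let $$R_qf(z)=\frac{f(z)-f(qz)}{(1-q)z}\quad(z\neq0),\qquad R_qf(0)=f'(0).$$ Then the following are equivalent: 1. (Realization) There are $N\in\mathbb N_0$ and matrices $(C,A,B)\in\mathbb C^{n\times N}\times\mathbb C^{N\times N}\times\mathbb C^{N\times m}$ such that, for all $z$ in a neighborhood of the origin, all the matrices $I_N-(1-q)zq^jA$, $j\ge0$, are invertible, the infinite product below converges, and $$T(z)=C\prod_{j=0}^\infty\bigl(I_N-(1-q)zq^jA\bigr)^{-1}B .$$ 2. (Hankel operator) The block Hankel operator $H=\bigl(T_{i+j}\,[i+j]_q!\bigr)_{i,j=0}^\infty$, acting from the finitely supported sequences in $\mathbb C^m$ to the sequences in $\mathbb C^n$, has finite rank. 3. (Taylor series) There are $N\in\mathbb N_0$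 and matrices $(C,A,B)\in\mathbb C^{n\times N}\times\mathbb C^{N\times N}\times\mathbb C^{N\times m}$ such that $$T_k=\frac{CA^kB}{[k]_q!},\qquad k=0,1,2,\ldots$$ 4. ($q$-Jackson derivative) The linear span of the columns of the functions $R_q^kT$, $k=0,1,2,\ldots$, as a space of $\mathbb C^n$-valued functions on the disk $|z|<r$, is finite dimensional. (For $N=0$ the product of an $n\times 0$ and a $0\times m$ matrix is the zero matrix.) -/

import Mathlib

open Filter Topology

/-- The `q`-number `[k]_q = 1 + q + ⋯ + q ^ (k - 1)`, for `k ≥ 1`. -/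
def qNumber (q : ℝ) (k : ℕ) : ℝ := ∑ i ∈ Finset.range k, q ^ i

/-- The `q`-factorial `[k]_q! = [1]_q [2]_q ⋯ [k]_q`, with `[0]_q! = 1`. -/
def qFactorial (q : ℝ) (k : ℕ) : ℝ := ∏ j ∈ Finset.range k, qNumber q (j + 1)

/-- The `j`-th factor `I - (1 - q) z q ^ j A` (before inversion). -/
def qFactor {N : ℕ} (q : ℝ) (A : Matrix (Fin N) (Fin N) ℂ) (z : ℂ) (j : ℕ) :
    Matrix (Fin N) (Fin N) ℂ :=
  1 - ((1 - (q : ℂ)) * z * (q : ℂ) ^ j) • A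

/-- `P` is the value of the infinite product `∏_{j ≥ 0} (I - (1 - q) z q ^ j A)⁻¹`: every factor
is invertible and the partial products converge to `P`. -/
def HasQProduct {N : ℕ} (q : ℝ) (A : Matrix (Fin N) (Fin N) ℂ) (z : ℂ)
    (P : Matrix (Fin N) (Fin N) ℂ) : Prop :=
  (∀ j, IsUnit (qFactor q A z j)) ∧
    Tendsto (fun J : ℕ => ((List.range J).map fun j => (qFactor q A z j)⁻¹).prod) atTop (𝓝 P)

/-- `T(z) = C (∏_{j ≥ 0} (I - (1 - q) z q ^ j A)⁻¹) B` for all `z` in a neighborhood of `0`. -/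
def HasQRealization {n m : ℕ} (q : ℝ) (T : ℂ → Matrix (Fin n) (Fin m) ℂ) : Prop :=
  ∃ (N : ℕ) (C : Matrix (Fin n) (Fin N) ℂ) (A : Matrix (Fin N) (Fin N) ℂ)
    (B : Matrix (Fin N) (Fin m) ℂ),
    ∀ᶠ z in 𝓝 (0 : ℂ), ∃ P, HasQProduct q A z P ∧ T z = C * P * B

/-- The infinite block Hankel matrix whose `(i, j)` block is `[i + j]_q! T_{i + j}`. -/
def qHankel {n m : ℕ} (q : ℝ) (t : ℕ → Matrix (Fin n) (Fin m) ℂ) :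
    Matrix (ℕ × Fin n) (ℕ × Fin m) ℂ :=
  fun a b => (qFactorial q (a.1 + b.1) : ℂ) * t (a.1 + b.1) a.2 b.2

/-- The block Hankel operator, `(H v)_a = ∑_b H_{a b} v_b`, acting on the finitely supported
sequences of vectors in `ℂ ^ m`, with values in the sequences of vectors in `ℂ ^ n`. -/
noncomputable def qHankelOperator {n m : ℕ} (q : ℝ) (t : ℕ → Matrix (Fin n) (Fin m) ℂ) :
    ((ℕ × Fin m) →₀ ℂ) →ₗ[ℂ] (ℕ × Fin n → ℂ) :=
  Finsupp.linearCombination ℂ fun b a => qHankel q t a b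

/-- The `q`-Jackson derivative `R_q f (z) = (f(z) - f(qz)) / ((1 - q) z)`, extended to `z = 0` by
continuity, that is by `f'(0)`. -/
noncomputable def qJackson {n m : ℕ} (q : ℝ) (f : ℂ → Matrix (Fin n) (Fin m) ℂ) :
    ℂ → Matrix (Fin n) (Fin m) ℂ :=
  fun z => if z = 0 then Matrix.of fun i j => deriv (fun w => f w i j) 0
    else ((1 - (q : ℂ)) * z)⁻¹ • (f z - f ((q : ℂ) * z))

/-- The linear span of the columns of the functions `R_q ^ k T`, `k = 0, 1, …`, as a space of
`ℂ ^ n`-valued functions on the disk `|z| < r`. The values of `R_q ^ k T` on this disk depend only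
on the values of `T` there. -/
def qJacksonSpan {n m : ℕ} (q r : ℝ) (T : ℂ → Matrix (Fin n) (Fin m) ℂ) :
    Submodule ℂ (Metric.ball (0 : ℂ) r → Fin n → ℂ) :=
  Submodule.span ℂ
    (Set.range fun (p : ℕ × Fin m) (z : Metric.ball (0 : ℂ) r) (i : Fin n) =>
      ((qJackson q)^[p.1] T) z i p.2)

/-!
Put `h k = [k]_q! T_k`. The matrix-valued `q`-exponential `E(a) = ∑ a ^ k / [k]_q!` satisfies
`(1 - (1 - q) a) E(a) = E(q a)`, so that the infinite product is `E(z A)` and a realization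
`(C, A, B)` of `T` amounts to `h k = C A ^ k B`. Since the columns of the block Hankel matrix of `h`
span a space invariant under the backward shift, this is possible exactly when that space is finite
dimensional: the space itself, with the shift as `A`, then provides a realization. Finally, `R_q`
acts on `∑ z ^ k h k / [k]_q!` by shifting `h`, so the columns of the functions `R_q ^ k T` satisfy
the same linear relations as the columns of the Hankel matrix.
-/

/-! ### Power series in one variable -/

section PowerSeries

variable {𝕜 E : Type*} [NontriviallyNormedField 𝕜] [NormedAddCommGroup E] [NormedSpace 𝕜 E]
  {c d : ℕ → E} {f : 𝕜 → E}

theorem exists_hasFPowerSeriesAt_zero (h : ∀ᶠ z in 𝓝 0, HasSum (fun k => z ^ k • c k) (f z)) :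
    ∃ p : FormalMultilinearSeries 𝕜 𝕜 E, HasFPowerSeriesAt f p 0 ∧ ∀ k, p.coeff k = c k := by
  let p : FormalMultilinearSeries 𝕜 𝕜 E := fun k =>
    ContinuousMultilinearMap.mkPiRing 𝕜 (Fin k) (c k)
  have hp (k : ℕ) : p.coeff k = c k := by simp [p, FormalMultilinearSeries.coeff]
  exact ⟨p, hasFPowerSeriesAt_iff'.2 (by simpa [hp] using h), hp⟩

theorem coeff_eq_of_eventually_hasSum (hc : ∀ᶠ z in 𝓝 0, HasSum (fun k => z ^ k • c k) (f z))
    (hd : ∀ᶠ z in 𝓝 0, HasSum (fun k => z ^ k • d k) (f z)) : c = d := by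
  obtain ⟨p, hp, hpc⟩ := exists_hasFPowerSeriesAt_zero hc
  obtain ⟨p', hp', hpd⟩ := exists_hasFPowerSeriesAt_zero hd
  funext k
  rw [← hpc, ← hpd, hp.eq_formalMultilinearSeries hp']

theorem deriv_zero_of_eventually_hasSum
    (h : ∀ᶠ z in 𝓝 0, HasSum (fun k => z ^ k • c k) (f z)) : deriv f 0 = c 1 := by
  obtain ⟨p, hp, hpc⟩ := exists_hasFPowerSeriesAt_zero h
  exact hp.deriv.trans (hpc 1)

end PowerSeries

section MatrixHasSum

variable {α l m n p R : Type*}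

theorem hasSum_matrix_iff [AddCommMonoid R] [TopologicalSpace R] {f : α → Matrix m n R}
    {S : Matrix m n R} : HasSum f S ↔ ∀ i j, HasSum (fun k => f k i j) (S i j) :=
  Pi.hasSum.trans (forall_congr' fun _ => Pi.hasSum)

theorem hasSum_matrix_mul_mul [Fintype m] [Fintype n] [Semiring R] [TopologicalSpace R]
    [IsTopologicalSemiring R] {f : α → Matrix m n R} {S : Matrix m n R} (hf : HasSum f S)
    (C : Matrix l m R) (B : Matrix n p R) : HasSum (fun k => C * f k * B) (C * S * B) :=
  hf.map ((Matrix.addMonoidHomMulRight B).comp (Matrix.addMonoidHomMulLeft C))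
    ((continuous_const.matrix_mul continuous_id).matrix_mul continuous_const)

end MatrixHasSum

/-! ### `q`-numbers and `q`-factorials -/

theorem qNumber_succ_ne_zero {q : ℝ} (hq : q ≠ -1) (k : ℕ) : qNumber q (k + 1) ≠ 0 :=
  geom_sum_ne_zero hq k.succ_ne_zero

theorem one_sub_mul_qNumber (q : ℝ) (k : ℕ) :
    (1 - (q : ℂ)) * (qNumber q k : ℂ) = 1 - (q : ℂ) ^ k := by
  exact_mod_cast mul_neg_geom_sum q k

theorem tendsto_qNumber {q : ℝ} (hq : |q| < 1) :
    Tendsto (qNumber q) atTop (𝓝 (1 - q)⁻¹) :=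
  (hasSum_geometric_of_abs_lt_one hq).tendsto_sum_nat

theorem qFactorial_zero (q : ℝ) : qFactorial q 0 = 1 := Finset.prod_range_zero _

theorem qFactorial_succ (q : ℝ) (k : ℕ) :
    qFactorial q (k + 1) = qFactorial q k * qNumber q (k + 1) :=
  Finset.prod_range_succ _ _

theorem qFactorial_ne_zero {q : ℝ} (hq : q ≠ -1) (k : ℕ) : qFactorial q k ≠ 0 :=
  Finset.prod_ne_zero_iff.2 fun j _ => qNumber_succ_ne_zero hq j

theorem ofReal_qFactorial_ne_zero {q : ℝ} (hq : q ≠ -1) (k : ℕ) : (qFactorial q k : ℂ) ≠ 0 :=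
  Complex.ofReal_ne_zero.2 (qFactorial_ne_zero hq k)

theorem inv_qFactorial_succ_mul_one_sub_pow {q : ℝ} (hq : q ≠ -1) (k : ℕ) :
    (qFactorial q (k + 1) : ℂ)⁻¹ * (1 - (q : ℂ) ^ (k + 1)) =
      (1 - (q : ℂ)) * (qFactorial q k : ℂ)⁻¹ := by
  have := Complex.ofReal_ne_zero.2 (qNumber_succ_ne_zero hq k)
  rw [← one_sub_mul_qNumber, qFactorial_succ, Complex.ofReal_mul]
  field_simp

theorem ne_neg_one_of_abs_lt_one {q : ℝ} (hq : |q| < 1) : q ≠ -1 := (abs_lt.1 hq).1.ne'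

/-! ### The `q`-exponential in a Banach algebra -/

section NormedSpace

variable {E : Type*} [SeminormedAddCommGroup E] [NormedSpace ℂ E]

theorem norm_ofReal_pow_smul_le {q : ℝ} (hq : |q| ≤ 1) (j : ℕ) (a : E) :
    ‖(q : ℂ) ^ j • a‖ ≤ ‖a‖ := by
  rw [norm_smul, norm_pow, Complex.norm_real]
  exact mul_le_of_le_one_left (norm_nonneg a) (pow_le_one₀ (norm_nonneg q) hq)

theorem norm_one_sub_smul_pow_smul_lt_one {q : ℝ} (hq : |q| < 1) {a : E}
    (ha : ‖(1 - (q : ℂ)) • a‖ < 1) (j : ℕ) : ‖(1 - (q : ℂ)) • (q : ℂ) ^ j • a‖ < 1 := by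
  rw [smul_comm]
  exact (norm_ofReal_pow_smul_le hq.le j _).trans_lt ha

end NormedSpace

section QExp

variable {𝔸 : Type*} [NormedRing 𝔸] [NormedAlgebra ℂ 𝔸]

/-- The `q`-exponential `∑ a ^ k / [k]_q!`. As a `tsum`, it is meaningful only where this series
converges, in particular for `‖(1 - q) a‖ < 1`. -/
noncomputable def qExp (q : ℝ) : 𝔸 → 𝔸 :=
  FormalMultilinearSeries.ofScalarsSum fun k => (qFactorial q k : ℂ)⁻¹

theorem qExp_zero (q : ℝ) : qExp q (0 : 𝔸) = 1 := by simp [qExp, qFactorial_zero]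

theorem le_radius_qExp (𝔸 : Type*) [NormedRing 𝔸] [NormedAlgebra ℂ 𝔸] {q : ℝ} (hq : |q| < 1) :
    ((1 - q).toNNReal⁻¹ : NNReal) ≤
      (FormalMultilinearSeries.ofScalars 𝔸 fun k => (qFactorial q k : ℂ)⁻¹).radius := by
  have hpos : 0 < 1 - q := sub_pos.2 (lt_of_abs_lt hq)
  apply FormalMultilinearSeries.inv_le_ofScalars_radius_of_tendsto _ _
    (Real.toNNReal_pos.2 hpos).ne'
  have hlim : Tendsto (fun k => ‖((qNumber q (k + 1) : ℝ) : ℂ)⁻¹‖) atTop (𝓝 (1 - q)) := by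
    simp only [norm_inv, Complex.norm_real]
    rw [← Real.norm_of_nonneg hpos.le, ← inv_inv ‖1 - q‖, ← norm_inv]
    exact ((tendsto_add_atTop_iff_nat 1).2 (tendsto_qNumber hq)).norm.inv₀
      (norm_ne_zero_iff.2 (inv_ne_zero hpos.ne'))
  rw [Real.coe_toNNReal _ hpos.le]
  refine hlim.congr fun k => ?_
  have := ofReal_qFactorial_ne_zero (ne_neg_one_of_abs_lt_one hq) k
  rw [← norm_div, Nat.succ_eq_add_one, qFactorial_succ, Complex.ofReal_mul, mul_inv,
    mul_div_cancel_left₀ _ (inv_ne_zero this)]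

variable [CompleteSpace 𝔸] {q : ℝ}

theorem hasSum_qExp (hq : |q| < 1) {a : 𝔸} (ha : ‖(1 - (q : ℂ)) • a‖ < 1) :
    HasSum (fun k => (qFactorial q k : ℂ)⁻¹ • a ^ k) (qExp q a) := by
  have hpos : 0 < 1 - q := sub_pos.2 (lt_of_abs_lt hq)
  have hnorm : ‖a‖₊ < (1 - q).toNNReal⁻¹ := by
    rw [NNReal.lt_inv_iff_mul_lt (Real.toNNReal_pos.2 hpos).ne', ← NNReal.coe_lt_coe,
      NNReal.coe_mul, Real.coe_toNNReal _ hpos.le, mul_comm]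
    rwa [norm_smul, ← Complex.ofReal_one, ← Complex.ofReal_sub, Complex.norm_real,
      Real.norm_of_nonneg hpos.le] at ha
  have hmem : a ∈ Metric.eball (0 : 𝔸)
      (FormalMultilinearSeries.ofScalars 𝔸 fun k => (qFactorial q k : ℂ)⁻¹).radius := by
    rw [mem_eball_zero_iff]
    exact (ENNReal.coe_lt_coe.2 hnorm).trans_le (le_radius_qExp 𝔸 hq)
  rw [← FormalMultilinearSeries.ofScalars_apply_eq']
  exact FormalMultilinearSeries.hasSum _ hmem

theorem continuousAt_qExp_zero (hq : |q| < 1) : ContinuousAt (qExp q) (0 : 𝔸) := by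
  have hpos : 0 < (1 - q).toNNReal⁻¹ :=
    inv_pos.2 (Real.toNNReal_pos.2 (sub_pos.2 (lt_of_abs_lt hq)))
  exact (FormalMultilinearSeries.hasFPowerSeriesOnBall _
    ((ENNReal.coe_pos.2 hpos).trans_le (le_radius_qExp 𝔸 hq))).hasFPowerSeriesAt.continuousAt

theorem one_sub_smul_mul_qExp (hq : |q| < 1) {a : 𝔸} (ha : ‖(1 - (q : ℂ)) • a‖ < 1) :
    (1 - (1 - (q : ℂ)) • a) * qExp q a = qExp q ((q : ℂ) • a) := by
  have hsum := hasSum_qExp hq ha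
  have hsum_q : HasSum (fun k => (qFactorial q k : ℂ)⁻¹ • ((q : ℂ) • a) ^ k)
      (qExp q ((q : ℂ) • a)) :=
    hasSum_qExp hq (by simpa using norm_one_sub_smul_pow_smul_lt_one hq ha 1)
  have hdiff := (hasSum_nat_add_iff' 1).2 (hsum.sub hsum_q)
  simp only [Finset.sum_range_one, pow_zero, sub_self, sub_zero] at hdiff
  have hterm (k : ℕ) : (qFactorial q (k + 1) : ℂ)⁻¹ • a ^ (k + 1) -
      (qFactorial q (k + 1) : ℂ)⁻¹ • ((q : ℂ) • a) ^ (k + 1) =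
        (1 - (q : ℂ)) • a * (qFactorial q k : ℂ)⁻¹ • a ^ k := by
    rw [smul_mul_smul_comm, ← pow_succ', smul_pow, smul_smul, ← sub_smul,
      ← inv_qFactorial_succ_mul_one_sub_pow (ne_neg_one_of_abs_lt_one hq), mul_one_sub]
  simp only [hterm] at hdiff
  rw [sub_mul, one_mul, (hsum.mul_left _).unique hdiff, sub_sub_cancel]

end QExp

/-! ### The infinite product -/

theorem tendsto_of_mul_eq_of_tendsto_one {α R : Type*} [NormedRing R] [HasSummableGeomSeries R]
    {l : Filter α} {u v : α → R} {x : R} (huv : ∀ j, u j * v j = x) (hv : Tendsto v l (𝓝 1)) :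
    Tendsto u l (𝓝 x) := by
  have hunit : ∀ᶠ j in l, IsUnit (v j) := hv.eventually (Units.isOpen.mem_nhds isUnit_one)
  have hinv : Tendsto (fun j => Ring.inverse (v j)) l (𝓝 1) := by
    simpa [Function.comp_def] using (NormedRing.inverse_continuousAt (1 : Rˣ)).tendsto.comp hv
  have hlim : Tendsto (fun j => x * Ring.inverse (v j)) l (𝓝 x) := by
    simpa using hinv.const_mul x
  refine hlim.congr' (hunit.mono fun j hj => ?_)
  rw [← huv j, Ring.mul_inverse_cancel_right _ _ hj]

section Product

open scoped Matrix.Norms.Operator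

variable {N : ℕ} {q : ℝ} {A : Matrix (Fin N) (Fin N) ℂ} {z : ℂ}

theorem qFactor_eq (q : ℝ) (A : Matrix (Fin N) (Fin N) ℂ) (z : ℂ) (j : ℕ) :
    qFactor q A z j = 1 - (1 - (q : ℂ)) • (q : ℂ) ^ j • z • A := by
  rw [qFactor, smul_smul, smul_smul, mul_assoc _ z, mul_comm z, mul_assoc]

theorem isUnit_qFactor (hq : |q| < 1) (hz : ‖(1 - (q : ℂ)) • z • A‖ < 1) (j : ℕ) :
    IsUnit (qFactor q A z j) := by
  rw [qFactor_eq]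
  exact isUnit_one_sub_of_norm_lt_one (norm_one_sub_smul_pow_smul_lt_one hq hz j)

theorem qFactor_mul_qExp (hq : |q| < 1) (hz : ‖(1 - (q : ℂ)) • z • A‖ < 1) (j : ℕ) :
    qFactor q A z j * qExp q ((q : ℂ) ^ j • z • A) = qExp q ((q : ℂ) ^ (j + 1) • z • A) := by
  rw [qFactor_eq, one_sub_smul_mul_qExp hq (norm_one_sub_smul_pow_smul_lt_one hq hz j),
    pow_succ', mul_smul]

theorem prod_inv_qFactor_mul_qExp (hq : |q| < 1) (hz : ‖(1 - (q : ℂ)) • z • A‖ < 1) (J : ℕ) :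
    ((List.range J).map fun j => (qFactor q A z j)⁻¹).prod * qExp q ((q : ℂ) ^ J • z • A) =
      qExp q (z • A) := by
  induction J with
  | zero => simp
  | succ J ih =>
    have hdet := (Matrix.isUnit_iff_isUnit_det _).1 (isUnit_qFactor hq hz J)
    rw [List.range_succ, List.map_append, List.prod_append, List.map_singleton,
      List.prod_singleton, ← qFactor_mul_qExp hq hz, mul_assoc,
      Matrix.nonsing_inv_mul_cancel_left _ _ hdet, ih]

theorem hasQProduct_qExp (hq : |q| < 1) (hz : ‖(1 - (q : ℂ)) • z • A‖ < 1) :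
    HasQProduct q A z (qExp q (z • A)) := by
  refine ⟨isUnit_qFactor hq hz,
    tendsto_of_mul_eq_of_tendsto_one (prod_inv_qFactor_mul_qExp hq hz) ?_⟩
  have hpow : Tendsto (fun J : ℕ => (q : ℂ) ^ J • z • A) atTop (𝓝 0) := by
    have : ‖(q : ℂ)‖ < 1 := by rwa [Complex.norm_real]
    simpa using (tendsto_pow_atTop_nhds_zero_of_norm_lt_one this).smul_const (z • A)
  simpa only [Function.comp_def, qExp_zero] using (continuousAt_qExp_zero hq).tendsto.comp hpow

theorem eventually_hasQProduct_and_hasSum (hq : |q| < 1) (A : Matrix (Fin N) (Fin N) ℂ) :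
    ∀ᶠ z in 𝓝 (0 : ℂ), ∃ P, HasQProduct q A z P ∧
      HasSum (fun k => z ^ k • (qFactorial q k : ℂ)⁻¹ • A ^ k) P := by
  have hcont : Continuous fun z : ℂ => ‖(1 - (q : ℂ)) • z • A‖ := by fun_prop
  have hsmall : ∀ᶠ z in 𝓝 (0 : ℂ), ‖(1 - (q : ℂ)) • z • A‖ < 1 :=
    (hcont.tendsto 0).eventually_lt_const (by simp)
  filter_upwards [hsmall] with z hz
  refine ⟨qExp q (z • A), hasQProduct_qExp hq hz, ?_⟩
  have hsum := hasSum_qExp hq hz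
  simp only [smul_pow, smul_comm _ (z ^ _)] at hsum
  exact hsum

end Product

/-! ### Realizations of matrix sequences and block Hankel matrices -/

section Realization

variable {R K ι κ : Type*} [Semiring R] [Field K]

/-- A sequence of matrices is *realizable* if it is the sequence `C A ^ k B` of Markov parameters
of a linear system `(C, A, B)` with finite-dimensional state space. -/
def IsRealizable (h : ℕ → Matrix ι κ R) : Prop :=
  ∃ (N : ℕ) (C : Matrix ι (Fin N) R) (A : Matrix (Fin N) (Fin N) R) (B : Matrix (Fin N) κ R),
    ∀ k, h k = C * A ^ k * B

theorem isRealizable_of_end {V : Type*} [AddCommGroup V] [Module K V] [FiniteDimensional K V]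
    (φ : ι → Module.Dual K V) (S : Module.End K V) (v : κ → V) :
    IsRealizable fun k => Matrix.of fun i b => φ i ((S ^ k) (v b)) := by
  let e := Module.finBasis K V
  refine ⟨_, .of fun i j => φ i (e j), LinearMap.toMatrix e e S, .of fun j b => e.repr (v b) j,
    fun k => ?_⟩
  ext i b
  have hrepr : (LinearMap.toMatrix e e (S ^ k)).mulVec (e.repr (v b)) = e.repr ((S ^ k) (v b)) :=
    LinearMap.toMatrix_mulVec_repr e e (S ^ k) (v b)
  calc φ i ((S ^ k) (v b)) = ∑ j, φ i (e j) * e.repr ((S ^ k) (v b)) j := by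
        conv_lhs => rw [← e.sum_repr ((S ^ k) (v b)), map_sum]
        simp only [map_smul, smul_eq_mul, mul_comm]
    _ = _ := by
        rw [← hrepr, LinearMap.toMatrix_pow, Matrix.mul_assoc]
        rfl

/-- The block Hankel matrix of a sequence of matrices, with `(i, j)` block `h (i + j)`. -/
def blockHankel {α : Type*} (h : ℕ → Matrix ι κ α) : Matrix (ℕ × ι) (ℕ × κ) α :=
  .of fun a b => h (a.1 + b.1) a.2 b.2

/-- The backward shift on sequences of vectors indexed by `ι`. -/
def backwardShift (R ι : Type*) [Semiring R] : Module.End R (ℕ × ι → R) :=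
  LinearMap.funLeft R R fun a => (a.1 + 1, a.2)

theorem backwardShift_col_blockHankel (h : ℕ → Matrix ι κ R) (k : ℕ) (b : κ) :
    backwardShift R ι ((blockHankel h).col (k, b)) = (blockHankel h).col (k + 1, b) := by
  funext a
  simp only [backwardShift, LinearMap.funLeft_apply, blockHankel, Matrix.col_apply,
    Matrix.of_apply, add_right_comm, add_assoc]

theorem IsRealizable.finiteDimensional_span_col_blockHankel {h : ℕ → Matrix ι κ K}
    (hh : IsRealizable h) :
    FiniteDimensional K (Submodule.span K (Set.range (blockHankel h).col)) := by
  obtain ⟨N, C, A, B, hCAB⟩ := hh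
  let observability : (Fin N → K) →ₗ[K] (ℕ × ι → K) :=
    LinearMap.pi fun a => LinearMap.proj a.2 ∘ₗ Matrix.mulVecLin (C * A ^ a.1)
  refine Submodule.finiteDimensional_of_le (S₂ := LinearMap.range observability) ?_
  rw [Submodule.span_le]
  rintro _ ⟨⟨k, b⟩, rfl⟩
  refine ⟨(A ^ k * B).col b, ?_⟩
  funext ⟨a, i⟩
  have hsplit : C * A ^ a * (A ^ k * B) = h (a + k) := by
    simp only [hCAB, pow_add, Matrix.mul_assoc]
  exact congrFun₂ hsplit i b

theorem isRealizable_of_finiteDimensional_span_col_blockHankel {h : ℕ → Matrix ι κ K}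
    (hfin : FiniteDimensional K (Submodule.span K (Set.range (blockHankel h).col))) :
    IsRealizable h := by
  set V := Submodule.span K (Set.range (blockHankel h).col) with hV
  have hcol (b : ℕ × κ) : (blockHankel h).col b ∈ V := Submodule.subset_span ⟨b, rfl⟩
  have hshift : V ≤ V.comap (backwardShift K ι) := by
    rw [hV, Submodule.span_le]
    rintro _ ⟨⟨k, b⟩, rfl⟩
    change backwardShift K ι _ ∈ V
    exact backwardShift_col_blockHankel h k b ▸ hcol _
  let S : Module.End K V := (backwardShift K ι).restrict hshift
  let v (k : ℕ) (b : κ) : V := ⟨_, hcol (k, b)⟩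
  have horbit (k : ℕ) (b : κ) : (S ^ k) (v 0 b) = v k b := by
    induction k with
    | zero => rfl
    | succ k ih =>
      rw [pow_succ', Module.End.mul_apply, ih]
      exact Subtype.ext (backwardShift_col_blockHankel h k b)
  let headCoord (i : ι) : Module.Dual K V := LinearMap.proj (0, i) ∘ₗ V.subtype
  convert isRealizable_of_end headCoord S (v 0) using 1
  ext k i b
  rw [Matrix.of_apply, horbit]
  simp [headCoord, v, blockHankel]

theorem finiteDimensional_span_col_blockHankel_iff {h : ℕ → Matrix ι κ K} :
    FiniteDimensional K (Submodule.span K (Set.range (blockHankel h).col)) ↔ IsRealizable h :=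
  ⟨isRealizable_of_finiteDimensional_span_col_blockHankel,
    IsRealizable.finiteDimensional_span_col_blockHankel⟩

end Realization

theorem hasQRealization_iff_isRealizable {n m : ℕ} {q : ℝ} (hq : |q| < 1)
    {h : ℕ → Matrix (Fin n) (Fin m) ℂ} {T : ℂ → Matrix (Fin n) (Fin m) ℂ}
    (hT : ∀ᶠ z in 𝓝 (0 : ℂ), HasSum (fun k => z ^ k • (qFactorial q k : ℂ)⁻¹ • h k) (T z)) :
    HasQRealization q T ↔ IsRealizable h := by
  have hsum {N : ℕ} (C : Matrix (Fin n) (Fin N) ℂ) (A : Matrix (Fin N) (Fin N) ℂ)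
      (B : Matrix (Fin N) (Fin m) ℂ) : ∀ᶠ z in 𝓝 (0 : ℂ), ∃ P, HasQProduct q A z P ∧
        HasSum (fun k => z ^ k • (qFactorial q k : ℂ)⁻¹ • (C * A ^ k * B)) (C * P * B) := by
    filter_upwards [eventually_hasQProduct_and_hasSum hq A] with z ⟨P, hP, hs⟩
    exact ⟨P, hP, by simpa using hasSum_matrix_mul_mul hs C B⟩
  constructor
  · rintro ⟨N, C, A, B, hreal⟩
    have hT' : ∀ᶠ z in 𝓝 (0 : ℂ),
        HasSum (fun k => z ^ k • (qFactorial q k : ℂ)⁻¹ • (C * A ^ k * B)) (T z) := by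
      filter_upwards [hreal, hsum C A B] with z ⟨P, hP, hTz⟩ ⟨P', hP', hs⟩
      rwa [hTz, tendsto_nhds_unique hP.2 hP'.2]
    have hcoeff := open scoped Matrix.Norms.Operator in coeff_eq_of_eventually_hasSum hT hT'
    have hfac := ofReal_qFactorial_ne_zero (ne_neg_one_of_abs_lt_one hq)
    exact ⟨N, C, A, B, fun k => smul_right_injective _ (inv_ne_zero (hfac k)) (congrFun hcoeff k)⟩
  · rintro ⟨N, C, A, B, hCAB⟩
    refine ⟨N, C, A, B, ?_⟩
    filter_upwards [hT, hsum C A B] with z hz ⟨P, hP, hs⟩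
    simp only [hCAB] at hz
    exact ⟨P, hP, hz.unique hs⟩

theorem isRealizable_qFactorial_smul_iff {ι κ : Type*} {q : ℝ} (hq : q ≠ -1)
    {t : ℕ → Matrix ι κ ℂ} :
    IsRealizable (fun k => (qFactorial q k : ℂ) • t k) ↔
      ∃ (N : ℕ) (C : Matrix ι (Fin N) ℂ) (A : Matrix (Fin N) (Fin N) ℂ)
        (B : Matrix (Fin N) κ ℂ), ∀ k, t k = (qFactorial q k : ℂ)⁻¹ • (C * A ^ k * B) := by
  simp only [IsRealizable, eq_inv_smul_iff₀ (ofReal_qFactorial_ne_zero hq _)]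

theorem range_qHankelOperator {n m : ℕ} (q : ℝ) (t : ℕ → Matrix (Fin n) (Fin m) ℂ) :
    LinearMap.range (qHankelOperator q t) =
      Submodule.span ℂ (Set.range (blockHankel fun k => (qFactorial q k : ℂ) • t k).col) :=
  Finsupp.range_linearCombination ℂ

/-! ### The `q`-Jackson derivative -/

theorem finiteDimensional_span_range_iff_of_ker_eq {K V W ι : Type*} [Field K] [AddCommGroup V]
    [Module K V] [AddCommGroup W] [Module K W] {u : ι → V} {v : ι → W}
    (huv : LinearMap.ker (Finsupp.linearCombination K u) =
      LinearMap.ker (Finsupp.linearCombination K v)) :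
    FiniteDimensional K (Submodule.span K (Set.range u)) ↔
      FiniteDimensional K (Submodule.span K (Set.range v)) := by
  simp only [← Finsupp.range_linearCombination K, FiniteDimensional, Module.Finite.iff_fg,
    Submodule.range_fg_iff_ker_cofg, huv]

section Jackson

variable {n m : ℕ} {q r : ℝ} {h : ℕ → Matrix (Fin n) (Fin m) ℂ}
  {f : ℂ → Matrix (Fin n) (Fin m) ℂ} {z : ℂ}

theorem qJackson_zero_of_eventually_hasSum {c : ℕ → Matrix (Fin n) (Fin m) ℂ}
    (hf : ∀ᶠ z in 𝓝 (0 : ℂ), HasSum (fun k => z ^ k • c k) (f z)) : qJackson q f 0 = c 1 := by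
  ext i j
  rw [qJackson, if_pos rfl, Matrix.of_apply]
  exact deriv_zero_of_eventually_hasSum (c := fun k => c k i j)
    (hf.mono fun z hz => hasSum_matrix_iff.1 hz i j)

theorem hasSum_qJackson_of_ne_zero (hq₁ : q ≠ 1) (hq : q ≠ -1) (hz : z ≠ 0)
    (hfz : HasSum (fun k => z ^ k • (qFactorial q k : ℂ)⁻¹ • h k) (f z))
    (hfqz : HasSum (fun k => (q * z) ^ k • (qFactorial q k : ℂ)⁻¹ • h k) (f (q * z))) :
    HasSum (fun k => z ^ k • (qFactorial q k : ℂ)⁻¹ • h (k + 1)) (qJackson q f z) := by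
  have hdiff := (hasSum_nat_add_iff' 1).2 (hfz.sub hfqz)
  simp only [Finset.sum_range_one, pow_zero, sub_self, sub_zero] at hdiff
  have hq1 : 1 - (q : ℂ) ≠ 0 := sub_ne_zero.2 (by exact_mod_cast hq₁.symm)
  have hcoeff (k : ℕ) : z ^ (k + 1) * (qFactorial q (k + 1) : ℂ)⁻¹ -
      (q * z) ^ (k + 1) * (qFactorial q (k + 1) : ℂ)⁻¹ =
        (1 - (q : ℂ)) * z * (z ^ k * (qFactorial q k : ℂ)⁻¹) := by
    linear_combination z ^ (k + 1) * inv_qFactorial_succ_mul_one_sub_pow hq k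
  simp only [smul_smul, ← sub_smul, hcoeff] at hdiff
  simp only [mul_smul ((1 - (q : ℂ)) * z)] at hdiff
  have hquot := hdiff.const_smul ((1 - (q : ℂ)) * z)⁻¹
  simp only [inv_smul_smul₀ (mul_ne_zero hq1 hz), mul_smul (z ^ _)] at hquot
  rwa [qJackson, if_neg hz]

theorem hasSum_qJackson (hq : |q| < 1)
    (hf : ∀ z ∈ Metric.ball (0 : ℂ) r,
      HasSum (fun k => z ^ k • (qFactorial q k : ℂ)⁻¹ • h k) (f z))
    (hz : z ∈ Metric.ball (0 : ℂ) r) :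
    HasSum (fun k => z ^ k • (qFactorial q k : ℂ)⁻¹ • h (k + 1)) (qJackson q f z) := by
  rcases eq_or_ne z 0 with rfl | hz0
  · rw [qJackson_zero_of_eventually_hasSum
      (eventually_of_mem (Metric.isOpen_ball.mem_nhds hz) hf)]
    convert hasSum_single 0 fun k hk => ?_ using 1
    · simp [qFactorial, qNumber]
    · simp [hk]
  · have hqz : (q : ℂ) * z ∈ Metric.ball (0 : ℂ) r := by
      rw [mem_ball_zero_iff] at hz ⊢
      simpa using (norm_ofReal_pow_smul_le hq.le 1 z).trans_lt hz
    exact hasSum_qJackson_of_ne_zero (lt_of_abs_lt hq).ne (ne_neg_one_of_abs_lt_one hq) hz0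
      (hf z hz) (hf _ hqz)

theorem hasSum_iterate_qJackson (hq : |q| < 1)
    (hf : ∀ z ∈ Metric.ball (0 : ℂ) r,
      HasSum (fun k => z ^ k • (qFactorial q k : ℂ)⁻¹ • h k) (f z)) (k : ℕ) :
    ∀ z ∈ Metric.ball (0 : ℂ) r,
      HasSum (fun j => z ^ j • (qFactorial q j : ℂ)⁻¹ • h (j + k)) ((qJackson q)^[k] f z) := by
  induction k with
  | zero => exact hf
  | succ k ih =>
    intro z hz
    rw [Function.iterate_succ_apply']
    simpa only [add_right_comm, ← add_assoc] using
      hasSum_qJackson (h := fun j => h (j + k)) hq ih hz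

/-- The columns of the functions `R_q ^ k T` on the disk `|z| < r`, indexed by `k` and the column
number. -/
noncomputable def qJacksonColumn (q r : ℝ) (T : ℂ → Matrix (Fin n) (Fin m) ℂ) (b : ℕ × Fin m) :
    Metric.ball (0 : ℂ) r → Fin n → ℂ :=
  fun z i => ((qJackson q)^[b.1] T) z i b.2

theorem hasSum_linearCombination_qJacksonColumn (hq : |q| < 1)
    (hf : ∀ z ∈ Metric.ball (0 : ℂ) r,
      HasSum (fun k => z ^ k • (qFactorial q k : ℂ)⁻¹ • h k) (f z))
    (c : (ℕ × Fin m) →₀ ℂ) (z : Metric.ball (0 : ℂ) r) (i : Fin n) :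
    HasSum (fun j => (z : ℂ) ^ j • ((qFactorial q j : ℂ)⁻¹ •
        Finsupp.linearCombination ℂ (blockHankel h).col c (j, i)))
      (Finsupp.linearCombination ℂ (qJacksonColumn q r f) c z i) := by
  have hcol (b : ℕ × Fin m) : HasSum
      (fun j => (z : ℂ) ^ j • (qFactorial q j : ℂ)⁻¹ • (blockHankel h).col b (j, i))
      (qJacksonColumn q r f b z i) :=
    hasSum_matrix_iff.1 (hasSum_iterate_qJackson hq hf b.1 z z.2) i b.2
  have hsum := hasSum_sum fun b (_ : b ∈ c.support) => (hcol b).const_smul (c b)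
  simpa only [Finsupp.linearCombination_apply, Finsupp.sum, Finset.sum_apply, Pi.smul_apply,
    Finset.smul_sum, smul_comm (c _)] using hsum

theorem ker_linearCombination_qJacksonColumn (hq : |q| < 1) (hr : 0 < r)
    (hf : ∀ z ∈ Metric.ball (0 : ℂ) r,
      HasSum (fun k => z ^ k • (qFactorial q k : ℂ)⁻¹ • h k) (f z)) :
    LinearMap.ker (Finsupp.linearCombination ℂ (qJacksonColumn q r f)) =
      LinearMap.ker (Finsupp.linearCombination ℂ (blockHankel h).col) := by
  ext c
  have hsum := hasSum_linearCombination_qJacksonColumn hq hf c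
  rw [LinearMap.mem_ker, LinearMap.mem_ker]
  constructor
  · intro hc
    funext ⟨j, i⟩
    have hcoeff : (fun j => (qFactorial q j : ℂ)⁻¹ •
        Finsupp.linearCombination ℂ (blockHankel h).col c (j, i)) = 0 := by
      refine coeff_eq_of_eventually_hasSum (f := fun _ : ℂ => (0 : ℂ)) ?_ (by simp)
      filter_upwards [Metric.ball_mem_nhds 0 hr] with z hz
      have hz_sum := hsum ⟨z, hz⟩ i
      rw [hc] at hz_sum
      exact hz_sum
    have hfac := ofReal_qFactorial_ne_zero (ne_neg_one_of_abs_lt_one hq) j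
    exact (smul_eq_zero_iff_right (inv_ne_zero hfac)).1 (congrFun hcoeff j)
  · intro hc
    funext z i
    refine (hsum z i).unique ?_
    simp [hc]

theorem finiteDimensional_qJacksonSpan_iff (hq : |q| < 1) (hr : 0 < r)
    (hf : ∀ z ∈ Metric.ball (0 : ℂ) r,
      HasSum (fun k => z ^ k • (qFactorial q k : ℂ)⁻¹ • h k) (f z)) :
    FiniteDimensional ℂ (qJacksonSpan q r f) ↔ IsRealizable h :=
  (finiteDimensional_span_range_iff_of_ker_eq
    (ker_linearCombination_qJacksonColumn hq hr hf)).trans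
    finiteDimensional_span_col_blockHankel_iff

end Jackson

theorem theorem5p7_general {n m : ℕ} (q : ℝ) (hq : |q| < 1)
    (r : ℝ) (hr : 0 < r)
    (t : ℕ → Matrix (Fin n) (Fin m) ℂ) (T : ℂ → Matrix (Fin n) (Fin m) ℂ)
    (hT : ∀ z ∈ Metric.ball (0 : ℂ) r, HasSum (fun k : ℕ => z ^ k • t k) (T z)) :
    List.TFAE [
      HasQRealization q T,
      FiniteDimensional ℂ (LinearMap.range (qHankelOperator q t)),
      ∃ (N : ℕ) (C : Matrix (Fin n) (Fin N) ℂ) (A : Matrix (Fin N) (Fin N) ℂ)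
        (B : Matrix (Fin N) (Fin m) ℂ),
        ∀ k : ℕ, t k = (qFactorial q k : ℂ)⁻¹ • (C * A ^ k * B),
      FiniteDimensional ℂ (qJacksonSpan q r T)] := by
  have hq' := ne_neg_one_of_abs_lt_one hq
  have hTaylor : ∀ z ∈ Metric.ball (0 : ℂ) r,
      HasSum (fun k => z ^ k • (qFactorial q k : ℂ)⁻¹ • (qFactorial q k : ℂ) • t k) (T z) := by
    simpa only [inv_smul_smul₀ (ofReal_qFactorial_ne_zero hq' _)] using hT
  have realization_iff := hasQRealization_iff_isRealizable hq
    (eventually_of_mem (Metric.ball_mem_nhds 0 hr) hTaylor)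
  have hankel_iff : FiniteDimensional ℂ (LinearMap.range (qHankelOperator q t)) ↔ _ :=
    range_qHankelOperator q t ▸ finiteDimensional_span_col_blockHankel_iff
  have taylor_iff := isRealizable_qFactorial_smul_iff hq' (t := t)
  have jackson_iff := finiteDimensional_qJacksonSpan_iff hq hr hTaylor
  tfae_have 1 ↔ 3 := realization_iff.trans taylor_iff
  tfae_have 2 ↔ 3 := hankel_iff.trans taylor_iff
  tfae_have 4 ↔ 3 := jackson_iff.trans taylor_iff
  tfae_finish

theorem theorem5p7 {n m : ℕ} (q : ℝ) (hq0 : 0 ≤ q) (hq1 : q < 1)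
    (r : ℝ) (hr : 0 < r)
    (t : ℕ → Matrix (Fin n) (Fin m) ℂ) (T : ℂ → Matrix (Fin n) (Fin m) ℂ)
    (hT : ∀ z ∈ Metric.ball (0 : ℂ) r, HasSum (fun k : ℕ => z ^ k • t k) (T z)) :
    List.TFAE [
      HasQRealization q T,
      FiniteDimensional ℂ (LinearMap.range (qHankelOperator q t)),
      ∃ (N : ℕ) (C : Matrix (Fin n) (Fin N) ℂ) (A : Matrix (Fin N) (Fin N) ℂ)
        (B : Matrix (Fin N) (Fin m) ℂ),
        ∀ k : ℕ, t k = (qFactorial q k : ℂ)⁻¹ • (C * A ^ k * B),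
      FiniteDimensional ℂ (qJacksonSpan q r T)] :=
  theorem5p7_general q (abs_lt.2 ⟨by linarith, hq1⟩) r hr t T hT
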